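/- Let $\Omega$ be a locally compact Hausdorff space with a Borel probability measure $\mu$. Let $\mathcal D_N=\{\varphi_1,\dots,\varphi_N\}$ be Borel measurable functions $\Omega\to\mathbb C$ with $\sup_{x\in\Omega}|\varphi_j(x)|\le 1$ for all $j$ and, for constants $0<R_1\le R_2<\infty$, $$R_1\Big(\sum_{j=1}^N|a_j|^2\Big)^{1/2}\le\Big\|\sum_{j=1}^N a_j\varphi_j\Big\|_{L_2(\mu)}\le R_2\Big(\sum_{j=1}^N|a_j|^2\Big)^{1/2}\qquad\text{for all }a\in\mathbb C^N .$$ Let $\Sigma_v(\mathcal D_N)$ be the union of the spans of all subfamilies of exactly $v$ elements of $\mathcal D_N$, and put $\sigma_v(f,\mathcal D_N)_X=\inf_{g\in\Sigma_v(\mathcal D_N)}\|f-g\|_X$; for $X=\infty$ the norm is $\|f\|_\infty=\sup_{x\in\Omega}|f(x)|$. Let $1\le u\le N$, and let $\xi^1,\dots,\xi^m\in\Omega$, $m\ge1$, be points (not necessarily distinct) that provide universal discretization: $$\tfrac12\|f\|_{L_2(\mu)}^2\le\frac1m\sum_{i=1}^m|f(\xi^i)|^2\le\tfrac32\|f\|_{L_2(\mu)}^2\qquad\text{for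 all }f\in\Sigma_u(\mathcal D_N).$$ Put $\Omega_m=\{\xi^1,\dots,\xi^m\}$, $\mu_m=\frac1m\sum_{i=1}^m\delta_{\xi^i}$ and $\mu_\xi=\frac12(\mu+\mu_m)$, and let $\mathcal D_N(\Omega_m)$ be the family of restrictions of the $\varphi_j$ to $\Omega_m$. For $t\in(0,1]$, the Weak Orthogonal Matching Pursuit $\mathrm{WOMP}(\mathcal D_N(\Omega_m);t)$ in $H=L_2(\Omega_m,\mu_m)$, applied to $f_0$, selects at the steps $k=1,2,\dots$ any index $j_k$ with $$|\langle f_{k-1},\psi_{j_k}\rangle_H|\ge t\max_{1\le i\le N}|\langle f_{k-1},\psi_i\rangle_H|,\qquad \psi_i=\varphi_i/\|\varphi_i\|_H,$$ and puts $f_k=f_0-G_k(f_0)$, where $G_k$ is the orthogonal projection of $H$ onto $\operatorname{span}\{\varphi_{j_1},\dots,\varphi_{j_k}\}$. On all of $\Omega$, $f_k$ denotes the function $f_0-G$, where $G$ is a linear combination of $\varphi_{j_1},\dots,\varphi_{j_k}$ on $\Omega$ whose restriction to $\Omega_m$ is $G_k(f_0)$. There are an absolute constant $C>1$ and, for all $t\in(0,1]$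 and $0<R_1\le R_2<\infty$, an integer $c=c(t,R_1,R_2)\ge1$ such that in every situation as above, for every integer $v\ge0$ with $(1+c)v\le u$, every bounded Borel measurable $f_0:\Omega\to\mathbb C$ and every admissible choice of the indices $j_k$, the function $f_{cv}$ on $\Omega$ exists and is unique, and $$\|f_{cv}\|_{L_2(\mu)}\le C\,\sigma_v(f_0,\mathcal D_N)_{L_2(\mu_\xi)} .$$ Moreover, with the same $c$ and $C$, $$\|f_{cv}\|_{L_2(\mu_m)}\le C\,\sigma_v(f_0,\mathcal D_N(\Omega_m))_{L_2(\mu_m)}\qquad\text{and}\qquad \|f_{cv}\|_{L_2(\mu)}\le C\,\sigma_v(f_0,\mathcal D_N)_\infty .$$ -/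

import Mathlib

open MeasureTheory

open scoped ENNReal

/-- The set `Σ_v` of `v`-sparse elements with respect to a finite dictionary `φ`:
the union of the spans of all subfamilies of exactly `v` dictionary elements. -/
def sparseSet {E : Type*} [AddCommGroup E] [Module ℂ E] {N : ℕ} (φ : Fin N → E) (v : ℕ) : Set E :=
  {g | ∃ J : Finset (Fin N), J.card = v ∧ g ∈ Submodule.span ℂ (φ '' (J : Set (Fin N)))}

/-- The best `v`-term approximation error `σ_v(f, φ) = inf_{g ∈ Σ_v} ‖f - g‖` in the norm `nrm`. -/
noncomputable def bestTermApprox {E : Type*} [AddCommGroup E] [Module ℂ E] {N : ℕ}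
    (nrm : E → ℝ) (φ : Fin N → E) (v : ℕ) (f : E) : ℝ :=
  ⨅ g : sparseSet φ v, nrm (f - (g : E))

/-- The norm of `L_2(ν)` of a complex valued function. -/
noncomputable def l2Norm {Ω : Type*} [MeasurableSpace Ω] (ν : Measure Ω) (f : Ω → ℂ) : ℝ :=
  (eLpNorm f 2 ν).toReal

/-- The uniform norm of a bounded function (the supremum over all points). -/
noncomputable def supNorm {Ω : Type*} (f : Ω → ℂ) : ℝ := ⨆ x, ‖f x‖

/-- `R₁ ‖a‖₂ ≤ ‖∑ aⱼ φⱼ‖_{L_2(μ)} ≤ R₂ ‖a‖₂` for all coefficient vectors `a`. -/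
def RieszBounds {Ω : Type*} [MeasurableSpace Ω] (μ : Measure Ω) {N : ℕ} (φ : Fin N → Ω → ℂ)
    (R₁ R₂ : ℝ) : Prop :=
  ∀ a : Fin N → ℂ,
    R₁ * Real.sqrt (∑ i, ‖a i‖ ^ 2) ≤ l2Norm μ (∑ i, a i • φ i) ∧
      l2Norm μ (∑ i, a i • φ i) ≤ R₂ * Real.sqrt (∑ i, ‖a i‖ ^ 2)

/-- The points `ξ` provide universal discretization of the `L_2(μ)` norm, with constants
`1/2` and `3/2`, for the collection of all spans of `u` dictionary elements. -/
def UniversalDiscretization {Ω : Type*} [MeasurableSpace Ω] (μ : Measure Ω) {N : ℕ}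
    (φ : Fin N → Ω → ℂ) (u : ℕ) {m : ℕ} (ξ : Fin m → Ω) : Prop :=
  ∀ f ∈ sparseSet φ u,
    1 / 2 * l2Norm μ f ^ 2 ≤ 1 / (m : ℝ) * ∑ i, ‖f (ξ i)‖ ^ 2 ∧
      1 / (m : ℝ) * ∑ i, ‖f (ξ i)‖ ^ 2 ≤ 3 / 2 * l2Norm μ f ^ 2

/-- The empirical measure `μ_m = (1/m) ∑ δ_{ξ_i}`. It lives on `Ω_m = {ξ_1, …, ξ_m}`, so that
`L_2(Ω, μ_m)` is `L_2(Ω_m, μ_m)`: its elements are the functions on `Ω_m`. -/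
noncomputable def empiricalMeasure {Ω : Type*} [MeasurableSpace Ω] {m : ℕ} (ξ : Fin m → Ω) :
    Measure Ω :=
  (m : ℝ≥0∞)⁻¹ • ∑ i, Measure.dirac (ξ i)

/-- The mixture `μ_ξ = (μ + μ_m) / 2`. -/
noncomputable def mixedMeasure {Ω : Type*} [MeasurableSpace Ω] (μ : Measure Ω) {m : ℕ}
    (ξ : Fin m → Ω) : Measure Ω :=
  (2 : ℝ≥0∞)⁻¹ • (μ + empiricalMeasure ξ)

/-- Every function is square integrable for the empirical measure. -/
theorem memLp_empiricalMeasure {Ω : Type*} [MeasurableSpace Ω] [MeasurableSingletonClass Ω]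
    {m : ℕ} (ξ : Fin m → Ω) (f : Ω → ℂ) : MemLp f 2 (empiricalMeasure ξ) := by
  have h1 : ∀ s : Finset (Fin m), MemLp f 2 (∑ i ∈ s, Measure.dirac (ξ i)) := by
    intro s
    induction s using Finset.induction_on with
    | empty => simp
    | insert a s ha ih =>
      rw [Finset.sum_insert ha]
      have hd : MemLp f 2 (Measure.dirac (ξ a)) :=
        (memLp_const (f (ξ a))).ae_eq (ae_eq_dirac f).symm
      have hae : AEStronglyMeasurable f
          (Measure.dirac (ξ a) + ∑ i ∈ s, Measure.dirac (ξ i)) :=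
        aestronglyMeasurable_add_measure_iff.2 ⟨hd.1, ih.1⟩
      rw [memLp_two_iff_integrable_sq_norm hae]
      exact ((memLp_two_iff_integrable_sq_norm hd.1).1 hd).add_measure
        ((memLp_two_iff_integrable_sq_norm ih.1).1 ih)
  rcases Nat.eq_zero_or_pos m with rfl | hm
  · simp [empiricalMeasure]
  · exact (h1 Finset.univ).smul_measure (by simp [hm.ne'])

/-- The restriction of a function to the sample points, as an element of `L_2(Ω_m, μ_m)`. -/
noncomputable def sampleL2 {Ω : Type*} [MeasurableSpace Ω] [MeasurableSingletonClass Ω]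
    {m : ℕ} (ξ : Fin m → Ω) (f : Ω → ℂ) : Lp ℂ 2 (empiricalMeasure ξ) :=
  (memLp_empiricalMeasure ξ f).toLp f

section WOMP

variable {H : Type*} [NormedAddCommGroup H] [InnerProductSpace ℂ H] {ι : Type*}

instance instFiniteDimensionalSpanSelected (φ : ι → H) (j : ℕ → ι) (k : ℕ) :
    FiniteDimensional ℂ (Submodule.span ℂ (Set.range fun i : Fin k => φ (j i))) :=
  FiniteDimensional.span_of_finite ℂ (Set.finite_range _)

/-- The residual `f_k = f₀ - G_k(f₀)` after `k` iterations, when the indices selected in the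
iterations are `j 0, j 1, …`: here `G_k(f₀)` is the orthogonal projection of `f₀` onto the span
of the `k` dictionary elements selected first. -/
noncomputable def wompResidual (φ : ι → H) (f₀ : H) (j : ℕ → ι) (k : ℕ) : H :=
  f₀ - (Submodule.span ℂ (Set.range fun i : Fin k => φ (j i))).starProjection f₀

/-- `j 0, j 1, …` is a possible sequence of selected indices in the Weak Orthogonal Matching
Pursuit with weakness parameter `t`, for the dictionary `φ`, applied to `f₀`: with
`ψ_i = φ_i / ‖φ_i‖`, the index selected in each iteration satisfies
`|⟨f_k, ψ_{j_k}⟩| ≥ t |⟨f_k, ψ_i⟩|` for every `i`, where `f_k` is the current residual. -/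
def IsWOMPSelection (φ : ι → H) (t : ℝ) (f₀ : H) (j : ℕ → ι) : Prop :=
  ∀ (k : ℕ) (i : ι),
    t * ‖inner ℂ (wompResidual φ f₀ j k) (((‖φ i‖⁻¹ : ℝ) : ℂ) • φ i)‖ ≤
      ‖inner ℂ (wompResidual φ f₀ j k) (((‖φ (j k)‖⁻¹ : ℝ) : ℂ) • φ (j k))‖

end WOMP

/-- `F : Ω → ℂ` is the residual after `k` iterations, as a function on all of `Ω`, of the
algorithm run on the restrictions of `φ` and `f₀` to the sample points with selected indices `j`:
`F = f₀ - G`, where `G` is a linear combination of `φ_{j 0}, …, φ_{j (k-1)}` on `Ω` and the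
restriction of `F` to the sample points is the `k`-th residual in `L_2(Ω_m, μ_m)`. -/
def IsResidualOn {Ω : Type*} [MeasurableSpace Ω] [MeasurableSingletonClass Ω] {N m : ℕ}
    (φ : Fin N → Ω → ℂ) (ξ : Fin m → Ω) (f₀ : Ω → ℂ) (j : ℕ → Fin N) (k : ℕ)
    (F : Ω → ℂ) : Prop :=
  f₀ - F ∈ Submodule.span ℂ (Set.range fun i : Fin k => φ (j i)) ∧
    sampleL2 ξ F = wompResidual (fun i => sampleL2 ξ (φ i)) (sampleL2 ξ f₀) j k

/-! ### Residuals as projections, and the gain of one greedy step. -/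

section GreedyHilbert

/-! Riesz bounds and universal discretization together make the restricted dictionary a restricted
isometry: in `L_2(Ω_m, μ_m)`, combinations of at most `u` elements have squared norm between `α =
R₁²/2` and `β = 3R₂²/2` times the sum of the squared coefficients (`sampleL2_riesz_bounds`). The
rest of the argument on the sample takes place in an abstract Hilbert space.

Suppose `z` uses the selected elements and at most `s` new ones. The residual is orthogonal to the
selected elements, so its correlation with `z` is carried by the new ones, and Cauchy-Schwarz forces
a large correlation with some dictionary element (`wompResidual_gap_le`). Hence the excess of the
squared residual over `‖f₀ - z‖²` shrinks by the factor `1 - t²α/(βs)` per iteration, and a number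
of iterations proportional to `s` makes it small (`norm_sq_wompResidual_add_le`).

Using this directly with all of a sparse approximant's support would leave a multiple of the initial
residual. Instead, the largest unselected coefficients are brought in over stages of doubling size,
stopping at the first stage `p` where the coefficient tail drops sharply. Then either the residual
is at most five times the approximation error, or at least `2 ^ p` indices of the support have been
newly selected, which pays for the iterations spent (`wompResidual_le_or_card_unselected_lt`).
Induction on the number of unselected indices gives `norm_wompResidual_le_sparse_error`.

To return to `Ω`, the difference between a sparse approximant and the algorithm's output is itself
`u`-sparse, so discretization bounds its `L_2(μ)` norm by its norm on the sample
(`l2Norm_residual_le`). -/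

theorem exists_sum_smul_eq_of_mem_span_image {H : Type*} [AddCommGroup H] [Module ℂ H]
    {ι : Type*} [DecidableEq ι] {φ : ι → H} {J : Finset ι} {x : H}
    (hx : x ∈ Submodule.span ℂ (φ '' (J : Set ι))) :
    ∃ a : ι → ℂ, ∑ i ∈ J, a i • φ i = x := by
  obtain ⟨w, rfl⟩ := (Submodule.mem_span_image_finset_iff_exists_fun ℂ).1 hx
  refine ⟨fun i => if h : i ∈ J then w ⟨i, h⟩ else 0, ?_⟩
  rw [← Finset.sum_coe_sort]
  exact Finset.sum_congr rfl fun i _ => by simp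

theorem range_selected_eq_image {H ι : Type*} [DecidableEq ι] (φ : ι → H) (j : ℕ → ι) (k : ℕ) :
    (Set.range fun i : Fin k => φ (j i)) = φ '' (((Finset.range k).image j : Finset ι) : Set ι) := by
  ext x
  simp only [Set.mem_range, Set.mem_image, Finset.mem_coe, Finset.mem_image, Finset.mem_range]
  constructor
  · rintro ⟨i, rfl⟩
    exact ⟨j i, ⟨i, i.2, rfl⟩, rfl⟩
  · rintro ⟨_, ⟨i, hi, rfl⟩, rfl⟩
    exact ⟨⟨i, hi⟩, rfl⟩

variable {H : Type*} [NormedAddCommGroup H] [InnerProductSpace ℂ H] {ι : Type*} [DecidableEq ι]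

theorem sub_wompResidual_mem (φ : ι → H) (f₀ : H) (j : ℕ → ι) (k : ℕ) :
    f₀ - wompResidual φ f₀ j k ∈
      Submodule.span ℂ (φ '' (((Finset.range k).image j : Finset ι) : Set ι)) := by
  rw [← range_selected_eq_image, wompResidual, sub_sub_cancel]
  exact Submodule.starProjection_apply_mem _ _

theorem inner_wompResidual_eq_zero (φ : ι → H) (f₀ : H) (j : ℕ → ι) {k : ℕ} {x : H}
    (hx : x ∈ Submodule.span ℂ (φ '' (((Finset.range k).image j : Finset ι) : Set ι))) :
    inner ℂ (wompResidual φ f₀ j k) x = 0 := by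
  rw [← range_selected_eq_image] at hx
  exact Submodule.starProjection_inner_eq_zero f₀ x hx

/-- Orthogonal projection is best approximation. Monotonicity, the one-step decrease and the case of
a fully selected support all come from choosing a competitor `x`. -/
theorem norm_wompResidual_le (φ : ι → H) (f₀ : H) (j : ℕ → ι) {k : ℕ} {x : H}
    (hx : x ∈ Submodule.span ℂ (φ '' (((Finset.range k).image j : Finset ι) : Set ι))) :
    ‖wompResidual φ f₀ j k‖ ≤ ‖f₀ - x‖ := by
  rw [← range_selected_eq_image] at hx
  rw [wompResidual, Submodule.starProjection_minimal]
  exact ciInf_le ⟨0, by rintro _ ⟨y, rfl⟩; exact norm_nonneg _⟩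
    (⟨x, hx⟩ : Submodule.span ℂ (Set.range fun i : Fin k => φ (j i)))

theorem span_selected_mono (φ : ι → H) (j : ℕ → ι) {k l : ℕ} (h : k ≤ l) :
    Submodule.span ℂ (φ '' (((Finset.range k).image j : Finset ι) : Set ι)) ≤
      Submodule.span ℂ (φ '' (((Finset.range l).image j : Finset ι) : Set ι)) := by
  apply Submodule.span_mono
  apply Set.image_mono
  exact_mod_cast Finset.image_subset_image (Finset.range_mono h)

theorem norm_wompResidual_antitone (φ : ι → H) (f₀ : H) (j : ℕ → ι) :
    Antitone fun k => ‖wompResidual φ f₀ j k‖ := by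
  intro k l h
  have := norm_wompResidual_le φ f₀ j (span_selected_mono φ j h (sub_wompResidual_mem φ f₀ j k))
  simpa using this

/-- The decrease of the squared residual in one iteration. -/
theorem norm_sq_wompResidual_succ_le (φ : ι → H) (f₀ : H) (j : ℕ → ι) (k : ℕ) :
    ‖wompResidual φ f₀ j (k + 1)‖ ^ 2 ≤ ‖wompResidual φ f₀ j k‖ ^ 2 -
      ‖inner ℂ (wompResidual φ f₀ j k) (((‖φ (j k)‖⁻¹ : ℝ) : ℂ) • φ (j k))‖ ^ 2 := by
  set r := wompResidual φ f₀ j k with hr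
  set e := ((‖φ (j k)‖⁻¹ : ℝ) : ℂ) • φ (j k) with he
  -- Only an inequality, since the selected element may vanish.
  have he1 : ‖e‖ ≤ 1 := by
    rw [he, norm_smul, Complex.norm_real, norm_inv, norm_norm]
    exact inv_mul_le_one
  have hemem : e ∈ Submodule.span ℂ
      (φ '' (((Finset.range (k + 1)).image j : Finset ι) : Set ι)) := by
    apply Submodule.smul_mem
    apply Submodule.subset_span
    refine ⟨j k, ?_, rfl⟩
    simp only [Finset.coe_image, Set.mem_image, Finset.mem_coe, Finset.mem_range]
    exact ⟨k, by omega, rfl⟩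
  -- The competitor is the old projection plus the component of the residual along `e`.
  have h1 := norm_wompResidual_le φ f₀ j (k := k + 1)
    (add_mem (span_selected_mono φ j (Nat.le_succ k) (sub_wompResidual_mem φ f₀ j k))
      (Submodule.smul_mem _ (inner ℂ e r) hemem))
  rw [← hr, show f₀ - (f₀ - r + inner ℂ e r • e) = r - inner ℂ e r • e by abel] at h1
  have h2 : ‖r - inner ℂ e r • e‖ ^ 2 =
      ‖r‖ ^ 2 - 2 * ‖inner ℂ r e‖ ^ 2 + ‖inner ℂ r e‖ ^ 2 * ‖e‖ ^ 2 := by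
    rw [norm_sub_sq (𝕜 := ℂ), inner_smul_right, norm_smul, mul_pow, norm_inner_symm e r,
      mul_comm (inner ℂ e r), inner_mul_symm_re_eq_norm, norm_mul, norm_inner_symm e r]
    ring
  have h3 : ‖e‖ ^ 2 ≤ 1 := pow_le_one₀ (norm_nonneg _) he1
  have h4 := pow_le_pow_left₀ (norm_nonneg _) h1 2
  nlinarith [sq_nonneg ‖inner ℂ r e‖]

/-- Approximation of `f₀` by a combination of few new dictionary elements forces a large
correlation of the residual with the dictionary. -/
theorem wompResidual_gap_le {φ : ι → H} {f₀ : H} {j : ℕ → ι} {u k : ℕ} {α s M : ℝ}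
    (hα : 0 < α)
    (hlow : ∀ J : Finset ι, J.card ≤ u → ∀ a : ι → ℂ,
      α * ∑ i ∈ J, ‖a i‖ ^ 2 ≤ ‖∑ i ∈ J, a i • φ i‖ ^ 2)
    (A : Finset ι) (hA : (A.card : ℝ) ≤ s) {z : H}
    (hz : z ∈ Submodule.span ℂ (φ '' ((A ∪ (Finset.range k).image j : Finset ι) : Set ι)))
    (hu : A.card + k ≤ u)
    (hM : ∀ i, ‖inner ℂ (wompResidual φ f₀ j k) (φ i)‖ ^ 2 ≤ M)
    (hgap : ‖f₀ - z‖ ^ 2 ≤ ‖wompResidual φ f₀ j k‖ ^ 2) :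
    α * (‖wompResidual φ f₀ j k‖ ^ 2 - ‖f₀ - z‖ ^ 2) ≤ s * M := by
  set r := wompResidual φ f₀ j k with hr
  set S := (Finset.range k).image j with hS
  have hcard : (A ∪ S).card ≤ u := by
    refine (Finset.card_union_le _ _).trans (le_trans ?_ hu)
    have := Finset.card_image_le (s := Finset.range k) (f := j)
    rw [Finset.card_range, ← hS] at this
    omega
  have hGz : z - (f₀ - r) ∈ Submodule.span ℂ (φ '' ((A ∪ S : Finset ι) : Set ι)) := by
    refine sub_mem hz (Submodule.span_mono (Set.image_mono ?_) (sub_wompResidual_mem φ f₀ j k))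
    exact_mod_cast Finset.subset_union_right
  obtain ⟨w, hw⟩ := exists_sum_smul_eq_of_mem_span_image hGz
  set d := z - (f₀ - r) with hd
  -- The selected indices drop out by orthogonality; only the new ones in `A` contribute.
  have hin : inner ℂ r d = ∑ i ∈ A, w i * inner ℂ r (φ i) := by
    rw [← hw, inner_sum]
    simp_rw [inner_smul_right]
    symm
    apply Finset.sum_subset Finset.subset_union_left
    intro i hi hiA
    have hiS : i ∈ S := (Finset.mem_union.1 hi).resolve_left hiA
    rw [inner_wompResidual_eq_zero φ f₀ j (Submodule.subset_span ⟨i, by exact_mod_cast hiS, rfl⟩),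
      mul_zero]
  have hM0 : ∀ i ∈ A, 0 ≤ M := fun i _ => (sq_nonneg _).trans (hM i)
  have hsM : ∑ i ∈ A, ‖inner ℂ r (φ i)‖ ^ 2 ≤ s * M := by
    rcases A.eq_empty_or_nonempty with rfl | ⟨i, hi⟩
    · simp only [Finset.sum_empty]
      simp only [Finset.card_empty, Nat.cast_zero] at hA
      by_contra hneg
      have : M < 0 := by
        by_contra h
        exact hneg (mul_nonneg hA (not_lt.1 h))
      exact absurd ((sq_nonneg _).trans (hM (j 0))) (not_le.2 this)
    · calc ∑ i ∈ A, ‖inner ℂ r (φ i)‖ ^ 2 ≤ ∑ i ∈ A, M := Finset.sum_le_sum fun i _ => hM i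
        _ = A.card * M := by rw [Finset.sum_const, nsmul_eq_mul]
        _ ≤ s * M := mul_le_mul_of_nonneg_right hA (hM0 i hi)
  have hCS : ‖inner ℂ r d‖ ^ 2 ≤ (∑ i ∈ A, ‖w i‖ ^ 2) * (s * M) := by
    rw [hin]
    calc ‖∑ i ∈ A, w i * inner ℂ r (φ i)‖ ^ 2
        ≤ (∑ i ∈ A, ‖w i‖ * ‖inner ℂ r (φ i)‖) ^ 2 := by
          gcongr
          refine (norm_sum_le _ _).trans (le_of_eq ?_)
          simp_rw [norm_mul]
      _ ≤ (∑ i ∈ A, ‖w i‖ ^ 2) * ∑ i ∈ A, ‖inner ℂ r (φ i)‖ ^ 2 :=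
          Finset.sum_mul_sq_le_sq_mul_sq _ _ _
      _ ≤ _ := by gcongr
  have hw2 : α * ∑ i ∈ A, ‖w i‖ ^ 2 ≤ ‖d‖ ^ 2 := by
    rw [← hw]
    refine le_trans ?_ (hlow _ hcard w)
    gcongr
    exact Finset.subset_union_left
  have hexp : ‖f₀ - z‖ ^ 2 = ‖r‖ ^ 2 - 2 * RCLike.re (inner ℂ r d) + ‖d‖ ^ 2 := by
    rw [← norm_sub_sq (𝕜 := ℂ)]
    congr 2
    rw [hd]; abel
  have hre : RCLike.re (inner ℂ r d) ≤ ‖inner ℂ r d‖ := RCLike.re_le_norm _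
  set x := ‖inner ℂ r d‖
  have hx0 : 0 ≤ x := norm_nonneg _
  set Δ := ‖r‖ ^ 2 - ‖f₀ - z‖ ^ 2 with hΔ
  have hΔ0 : 0 ≤ Δ := sub_nonneg.2 hgap
  -- Since `f₀ - z = r - d`, expanding the square gives this bound; the arithmetic-geometric mean
  -- inequality turns it into `Δ‖d‖² ≤ x²`, and dividing by `‖d‖²` finishes unless `d = 0`.
  have h1 : Δ + ‖d‖ ^ 2 ≤ 2 * x := by linarith
  have hsM0 : 0 ≤ s * M := le_trans (Finset.sum_nonneg fun i _ => sq_nonneg _) hsM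
  have h2 : Δ * ‖d‖ ^ 2 ≤ x ^ 2 := by
    nlinarith [sq_nonneg (Δ - ‖d‖ ^ 2), sq_nonneg ‖d‖]
  have h3 : α * x ^ 2 ≤ ‖d‖ ^ 2 * (s * M) := by
    nlinarith [mul_le_mul_of_nonneg_left hCS hα.le, mul_le_mul_of_nonneg_right hw2 hsM0]
  rcases (sq_nonneg ‖d‖).eq_or_lt' with h0 | h0
  · have hx2 : x ^ 2 ≤ 0 := by
      have : α * x ^ 2 ≤ 0 := by rw [h0, zero_mul] at h3; exact h3
      nlinarith
    have hx : x = 0 := by nlinarith [sq_nonneg x, pow_eq_zero_iff (two_ne_zero) |>.1 (le_antisymm hx2 (sq_nonneg x))]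
    have : Δ = 0 := by nlinarith
    rw [this, mul_zero]
    exact hsM0
  · have : (α * Δ) * ‖d‖ ^ 2 ≤ (s * M) * ‖d‖ ^ 2 := by nlinarith
    exact le_of_mul_le_mul_right this h0

/-- The decrease of the squared residual in one iteration, compared with the error of
approximation by a combination of few new dictionary elements. -/
theorem max_wompResidual_gap_succ_le {φ : ι → H} {f₀ : H} {j : ℕ → ι} {u k : ℕ} {t α β s : ℝ}
    (ht : 0 < t) (hα : 0 < α) (hβ : 0 < β) (hs : 0 < s)
    (hlow : ∀ J : Finset ι, J.card ≤ u → ∀ a : ι → ℂ,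
      α * ∑ i ∈ J, ‖a i‖ ^ 2 ≤ ‖∑ i ∈ J, a i • φ i‖ ^ 2)
    (hφ : ∀ i, ‖φ i‖ ^ 2 ≤ β)
    (hj : IsWOMPSelection φ t f₀ j)
    (A : Finset ι) (hA : (A.card : ℝ) ≤ s) {z : H}
    (hz : z ∈ Submodule.span ℂ (φ '' ((A ∪ (Finset.range k).image j : Finset ι) : Set ι)))
    (hu : A.card + k ≤ u) (hθ : t ^ 2 * α / β / s ≤ 1) :
    max (‖wompResidual φ f₀ j (k + 1)‖ ^ 2 - ‖f₀ - z‖ ^ 2) 0 ≤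
      (1 - t ^ 2 * α / β / s) * max (‖wompResidual φ f₀ j k‖ ^ 2 - ‖f₀ - z‖ ^ 2) 0 := by
  set r := wompResidual φ f₀ j k with hr
  have hstep := norm_sq_wompResidual_succ_le φ f₀ j k
  rw [← hr] at hstep
  set x := ‖inner ℂ r (((‖φ (j k)‖⁻¹ : ℝ) : ℂ) • φ (j k))‖ with hx
  -- The weak greedy rule concerns normalized elements; removing the normalization costs `β`, the
  -- weakness costs `1 / t²`.
  have hM : ∀ i, ‖inner ℂ r (φ i)‖ ^ 2 ≤ x ^ 2 * β / t ^ 2 := by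
    intro i
    rw [le_div_iff₀ (by positivity)]
    rcases eq_or_ne (φ i) 0 with h0 | h0
    · rw [h0, inner_zero_right, norm_zero, zero_pow two_ne_zero, zero_mul]
      have := hβ.le
      positivity
    have hn : 0 < ‖φ i‖ := norm_pos_iff.2 h0
    have h1 := hj k i
    rw [← hr, ← hx, inner_smul_right, norm_mul, Complex.norm_real, norm_inv, norm_norm] at h1
    have h2 : ‖inner ℂ r (φ i)‖ * t ≤ x * ‖φ i‖ := by
      calc ‖inner ℂ r (φ i)‖ * t = (t * (‖φ i‖⁻¹ * ‖inner ℂ r (φ i)‖)) * ‖φ i‖ := by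
            field_simp
        _ ≤ _ := by gcongr
    calc ‖inner ℂ r (φ i)‖ ^ 2 * t ^ 2 = (‖inner ℂ r (φ i)‖ * t) ^ 2 := by ring
      _ ≤ (x * ‖φ i‖) ^ 2 := by gcongr
      _ = x ^ 2 * ‖φ i‖ ^ 2 := by ring
      _ ≤ _ := by gcongr; exact hφ i
  apply max_le _ (mul_nonneg (sub_nonneg.2 hθ) (le_max_right _ _))
  rcases le_total (‖f₀ - z‖ ^ 2) (‖r‖ ^ 2) with h | h
  · rw [max_eq_left (sub_nonneg.2 h)]
    have hg := wompResidual_gap_le hα hlow A hA hz hu hM h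
    rw [← hr] at hg
    have : t ^ 2 * α / β / s * (‖r‖ ^ 2 - ‖f₀ - z‖ ^ 2) ≤ x ^ 2 := by
      rw [div_div, div_mul_eq_mul_div, div_le_iff₀ (mul_pos hβ hs)]
      have h5 := mul_le_mul_of_nonneg_left hg (sq_nonneg t)
      have h6 : t ^ 2 * (s * (x ^ 2 * β / t ^ 2)) = x ^ 2 * (β * s) := by field_simp
      linarith
    linarith
  · rw [max_eq_right (sub_nonpos.2 h), mul_zero]
    nlinarith [sq_nonneg x]

/-- The decay of the squared residual along several iterations. -/
theorem norm_sq_wompResidual_add_le {φ : ι → H} {f₀ : H} {j : ℕ → ι} {u k K : ℕ}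
    {t α β s ε : ℝ}
    (ht : 0 < t) (hα : 0 < α) (hβ : 0 < β) (hs : 0 < s)
    (hlow : ∀ J : Finset ι, J.card ≤ u → ∀ a : ι → ℂ,
      α * ∑ i ∈ J, ‖a i‖ ^ 2 ≤ ‖∑ i ∈ J, a i • φ i‖ ^ 2)
    (hφ : ∀ i, ‖φ i‖ ^ 2 ≤ β)
    (hj : IsWOMPSelection φ t f₀ j)
    (A : Finset ι) (hA : (A.card : ℝ) ≤ s) {z : H}
    (hz : z ∈ Submodule.span ℂ (φ '' ((A ∪ (Finset.range k).image j : Finset ι) : Set ι)))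
    (hu : A.card + (k + K) ≤ u) (hθ : t ^ 2 * α / β / s ≤ 1)
    (hε : Real.exp (-(t ^ 2 * α / β / s * K)) ≤ ε) :
    ‖wompResidual φ f₀ j (k + K)‖ ^ 2 ≤
      ‖f₀ - z‖ ^ 2 + ε * ‖wompResidual φ f₀ j k‖ ^ 2 := by
  set θ := t ^ 2 * α / β / s with hθd
  have key : ∀ n ≤ K, max (‖wompResidual φ f₀ j (k + n)‖ ^ 2 - ‖f₀ - z‖ ^ 2) 0 ≤
      (1 - θ) ^ n * max (‖wompResidual φ f₀ j k‖ ^ 2 - ‖f₀ - z‖ ^ 2) 0 := by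
    intro n
    induction n with
    | zero => intro _; simp
    | succ n ih =>
      intro hn
      have hz' : z ∈ Submodule.span ℂ
          (φ '' ((A ∪ (Finset.range (k + n)).image j : Finset ι) : Set ι)) := by
        refine Submodule.span_mono (Set.image_mono ?_) hz
        exact_mod_cast Finset.union_subset_union_right
          (Finset.image_subset_image (Finset.range_mono (Nat.le_add_right k n)))
      have h1 := max_wompResidual_gap_succ_le (k := k + n) ht hα hβ hs hlow hφ hj A hA hz'
        (by omega) hθ
      refine h1.trans ?_
      rw [pow_succ' (1 - θ), mul_assoc]
      exact mul_le_mul_of_nonneg_left (ih (by omega)) (sub_nonneg.2 hθ)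
  have h1 := (le_max_left _ _).trans (key K le_rfl)
  have h2 : (1 - θ) ^ K ≤ ε := by
    refine le_trans ?_ hε
    calc (1 - θ) ^ K ≤ (Real.exp (-θ)) ^ K :=
          pow_le_pow_left₀ (sub_nonneg.2 hθ) (Real.one_sub_le_exp_neg θ) K
      _ = _ := by rw [← Real.exp_nat_mul]; congr 1; ring
  have h3 : max (‖wompResidual φ f₀ j k‖ ^ 2 - ‖f₀ - z‖ ^ 2) 0 ≤
      ‖wompResidual φ f₀ j k‖ ^ 2 :=
    max_le (by linarith [sq_nonneg ‖f₀ - z‖]) (sq_nonneg _)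
  have h4 := mul_le_mul h2 h3 (le_max_right _ _) ((pow_nonneg (sub_nonneg.2 hθ) K).trans h2)
  linarith

end GreedyHilbert

/-! ### Doubling stages and the sparse error bound in a Hilbert space. -/

/-- For every `s` some subset of at most `s` elements leaves the least possible remaining sum. -/
theorem exists_optimal_subsets {ι : Type*} [DecidableEq ι] (q : ι → ℝ) (Γ : Finset ι) :
    ∃ A : ℕ → Finset ι, ∀ s, A s ⊆ Γ ∧ (A s).card ≤ s ∧
      ∀ A' ⊆ Γ, A'.card ≤ s → ∑ i ∈ Γ \ A s, q i ≤ ∑ i ∈ Γ \ A', q i := by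
  have : ∀ s : ℕ, ∃ A : Finset ι, A ⊆ Γ ∧ A.card ≤ s ∧
      ∀ A' ⊆ Γ, A'.card ≤ s → ∑ i ∈ Γ \ A, q i ≤ ∑ i ∈ Γ \ A', q i := by
    intro s
    obtain ⟨A, hA, hmin⟩ := Finset.exists_min_image (Γ.powerset.filter fun A => A.card ≤ s)
      (fun A => ∑ i ∈ Γ \ A, q i) ⟨∅, by simp⟩
    simp only [Finset.mem_filter, Finset.mem_powerset] at hA hmin
    exact ⟨A, hA.1, hA.2, fun A' h1 h2 => hmin A' ⟨h1, h2⟩⟩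
  choose A hA using this
  exact ⟨A, hA⟩

section GreedyHilbert

variable {H : Type*} [NormedAddCommGroup H] [InnerProductSpace ℂ H] {ι : Type*} [DecidableEq ι]

/-- Replacing a sparse approximant by its restriction to the selected and a few further indices. -/
theorem exists_partial_approximant {φ : ι → H} {f₀ : H} {u : ℕ} {β : ℝ}
    (hup : ∀ J : Finset ι, J.card ≤ u → ∀ a : ι → ℂ,
      ‖∑ i ∈ J, a i • φ i‖ ^ 2 ≤ β * ∑ i ∈ J, ‖a i‖ ^ 2)
    (T S A : Finset ι) (hT : T.card ≤ u) (g : ι → ℂ) :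
    ∃ z ∈ Submodule.span ℂ (φ '' ((A ∪ S : Finset ι) : Set ι)),
      ‖f₀ - z‖ ^ 2 ≤ 2 * ‖f₀ - ∑ i ∈ T, g i • φ i‖ ^ 2 +
        2 * β * ∑ i ∈ (T \ S) \ A, ‖g i‖ ^ 2 := by
  have hsub : (T \ S) \ A ⊆ T := Finset.sdiff_subset.trans Finset.sdiff_subset
  refine ⟨∑ i ∈ T \ ((T \ S) \ A), g i • φ i, ?_, ?_⟩
  · refine Submodule.sum_mem _ fun i hi => Submodule.smul_mem _ _ (Submodule.subset_span ⟨i, ?_, rfl⟩)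
    simp only [Finset.mem_sdiff, Finset.coe_union, Set.mem_union, Finset.mem_coe] at hi ⊢
    tauto
  · have h1 := hup _ ((Finset.card_le_card hsub).trans hT) g
    have h2 : f₀ - ∑ i ∈ T \ ((T \ S) \ A), g i • φ i =
        (f₀ - ∑ i ∈ T, g i • φ i) + ∑ i ∈ (T \ S) \ A, g i • φ i := by
      rw [← Finset.sum_sdiff hsub]; abel
    rw [h2]
    set x := f₀ - ∑ i ∈ T, g i • φ i
    set y := ∑ i ∈ (T \ S) \ A, g i • φ i
    have h3 : ‖x + y‖ ^ 2 ≤ (‖x‖ + ‖y‖) ^ 2 :=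
      pow_le_pow_left₀ (norm_nonneg _) (norm_add_le _ _) 2
    nlinarith [sq_nonneg (‖x‖ - ‖y‖)]

/-- The coefficients of a sparse approximant outside of the selected indices are controlled by
the residual. -/
theorem sum_sq_unselected_le {φ : ι → H} {f₀ : H} {j : ℕ → ι} {u k : ℕ} {α : ℝ} (hα : 0 < α)
    (hlow : ∀ J : Finset ι, J.card ≤ u → ∀ a : ι → ℂ,
      α * ∑ i ∈ J, ‖a i‖ ^ 2 ≤ ‖∑ i ∈ J, a i • φ i‖ ^ 2)
    (T : Finset ι) (hu : T.card + k ≤ u) (g : ι → ℂ) :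
    α * ∑ i ∈ T \ (Finset.range k).image j, ‖g i‖ ^ 2 ≤
      (‖f₀ - ∑ i ∈ T, g i • φ i‖ + ‖wompResidual φ f₀ j k‖) ^ 2 := by
  set S := (Finset.range k).image j with hS
  obtain ⟨b, hb⟩ := exists_sum_smul_eq_of_mem_span_image (sub_wompResidual_mem φ f₀ j k)
  rw [← hS] at hb
  have hcard : (T ∪ S).card ≤ u := by
    refine (Finset.card_union_le _ _).trans (le_trans ?_ hu)
    have := Finset.card_image_le (s := Finset.range k) (f := j)
    rw [Finset.card_range, ← hS] at this
    omega
  -- Coefficients of the approximant minus those of the projection: they agree with `g` on `T \ S`,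
  -- and their combination is a difference of two errors.
  set w : ι → ℂ := fun i => (if i ∈ T then g i else 0) - if i ∈ S then b i else 0 with hw
  have hsum : ∑ i ∈ T ∪ S, w i • φ i =
      wompResidual φ f₀ j k - (f₀ - ∑ i ∈ T, g i • φ i) := by
    have e1 : ∑ i ∈ T ∪ S, (if i ∈ T then g i else 0) • φ i = ∑ i ∈ T, g i • φ i := by
      simp_rw [ite_smul, zero_smul]
      rw [Finset.sum_ite_mem, Finset.union_inter_cancel_left]
    have e2 : ∑ i ∈ T ∪ S, (if i ∈ S then b i else 0) • φ i = ∑ i ∈ S, b i • φ i := by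
      simp_rw [ite_smul, zero_smul]
      rw [Finset.sum_ite_mem, Finset.union_inter_cancel_right]
    simp_rw [hw, sub_smul]
    rw [Finset.sum_sub_distrib, e1, e2, hb]
    abel
  have h1 := hlow _ hcard w
  rw [hsum] at h1
  have h2 : ∑ i ∈ T \ S, ‖g i‖ ^ 2 ≤ ∑ i ∈ T ∪ S, ‖w i‖ ^ 2 := by
    calc ∑ i ∈ T \ S, ‖g i‖ ^ 2 = ∑ i ∈ T \ S, ‖w i‖ ^ 2 := by
          refine Finset.sum_congr rfl fun i hi => ?_
          rw [Finset.mem_sdiff] at hi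
          simp [hw, hi.1, hi.2]
      _ ≤ _ := Finset.sum_le_sum_of_subset_of_nonneg
          (Finset.sdiff_subset.trans Finset.subset_union_left) fun i _ _ => sq_nonneg _
  calc _ ≤ α * ∑ i ∈ T ∪ S, ‖w i‖ ^ 2 := by gcongr
    _ ≤ _ := h1
    _ ≤ _ := by
      gcongr
      rw [add_comm]
      exact norm_sub_le _ _

/-- After a number of iterations proportional to the number of unselected indices of a sparse
approximant, either the residual is comparable with the error of approximation, or a proportional
number of further indices has been selected. -/
theorem wompResidual_le_or_card_unselected_lt {φ : ι → H} {f₀ : H} {j : ℕ → ι} {u k B : ℕ}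
    {t α β : ℝ}
    (ht : 0 < t) (ht1 : t ≤ 1) (hα : 0 < α) (hαβ : α ≤ β)
    (hlow : ∀ J : Finset ι, J.card ≤ u → ∀ a : ι → ℂ,
      α * ∑ i ∈ J, ‖a i‖ ^ 2 ≤ ‖∑ i ∈ J, a i • φ i‖ ^ 2)
    (hup : ∀ J : Finset ι, J.card ≤ u → ∀ a : ι → ℂ,
      ‖∑ i ∈ J, a i • φ i‖ ^ 2 ≤ β * ∑ i ∈ J, ‖a i‖ ^ 2)
    (hφ : ∀ i, ‖φ i‖ ^ 2 ≤ β)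
    (hj : IsWOMPSelection φ t f₀ j)
    (hB : Real.exp (-(t ^ 2 * α / β * B)) ≤ α / (32 * β))
    (T : Finset ι) (g : ι → ℂ)
    (hΓ : 0 < (T \ (Finset.range k).image j).card)
    (hu : T.card + (k + 4 * B * (T \ (Finset.range k).image j).card) ≤ u) :
    ‖wompResidual φ f₀ j (k + 4 * B * (T \ (Finset.range k).image j).card)‖ ≤
        5 * ‖f₀ - ∑ i ∈ T, g i • φ i‖ ∨
      ∃ k', k' + 4 * B * (T \ (Finset.range k').image j).card ≤
          k + 4 * B * (T \ (Finset.range k).image j).card ∧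
        (T \ (Finset.range k').image j).card < (T \ (Finset.range k).image j).card := by
  have hβ : 0 < β := hα.trans_le hαβ
  set S := (Finset.range k).image j with hS
  set Γ := T \ S with hΓd
  set e := ‖f₀ - ∑ i ∈ T, g i • φ i‖ with he
  have he0 : 0 ≤ e := norm_nonneg _
  have hΓT : Γ.card ≤ T.card := Finset.card_le_card Finset.sdiff_subset
  obtain ⟨A, hA⟩ := exists_optimal_subsets (fun i => ‖g i‖ ^ 2) Γ
  -- The `- 1` makes stage 0 use no new index, and makes "more than `2 ^ p - 1` captured" mean at
  -- least `2 ^ p` at the end.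
  set τ : ℕ → ℝ := fun l => ∑ i ∈ Γ \ A (2 ^ l - 1), ‖g i‖ ^ 2 with hτ
  have hτ0 : ∀ l, 0 ≤ τ l := fun l => Finset.sum_nonneg fun i _ => sq_nonneg _
  have hτz : ∀ l, Γ.card ≤ 2 ^ l - 1 → τ l = 0 := by
    intro l hl
    have := (hA (2 ^ l - 1)).2.2 Γ subset_rfl hl
    simp only [Finset.sdiff_self, Finset.sum_empty] at this
    exact le_antisymm this (hτ0 l)
  -- Chosen so that `ε * M = 1 / 2`: one stage's contraction `ε` absorbs a tail drop by a factor up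
  -- to `M`.
  set M : ℝ := 16 * β / α with hM
  have hM16 : 16 ≤ M := by
    rw [hM, le_div_iff₀ hα]; linarith
  set ε : ℝ := α / (32 * β) with hεd
  have hεM : ε * M = 1 / 2 := by rw [hεd, hM]; field_simp; norm_num
  have hMβ : M * α = 16 * β := by rw [hM]; field_simp
  have hε0 : 0 < ε := by positivity
  have hε1 : ε ≤ 1 / 32 := by nlinarith
  have hex : ∃ l, M * τ (l + 1) ≤ τ l := by
    refine ⟨Γ.card, ?_⟩
    have h2 : Γ.card < 2 ^ (Γ.card + 1) := Nat.lt_two_pow_self.trans (Nat.pow_lt_pow_succ (by norm_num))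
    rw [hτz _ (by omega), mul_zero]
    exact hτ0 _
  -- The first sharp drop of the tail. Positivity of the earlier tails yields `2 ^ p ≤ Γ.card`, so
  -- that the stages fit in the budget.
  obtain ⟨p, hp, hpmin⟩ : ∃ p, M * τ (p + 1) ≤ τ p ∧ ∀ l < p, τ l ≤ M * τ (l + 1) ∧
      0 < τ (l + 1) := by
    classical
    refine ⟨Nat.find hex, Nat.find_spec hex, fun l hl => ?_⟩
    have := not_le.1 (Nat.find_min hex hl)
    refine ⟨this.le, ?_⟩
    have h3 := (hτ0 l).trans_lt this
    exact pos_of_mul_pos_right h3 (by linarith)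
  have hpΓ : 2 ^ p ≤ Γ.card := by
    rcases p with _ | p
    · simpa using hΓ
    · have := (hpmin p (Nat.lt_succ_self p)).2
      by_contra hcon
      rw [hτz (p + 1) (by omega)] at this
      exact lt_irrefl _ this
  have hBp : 4 * B * 2 ^ p ≤ 4 * B * Γ.card := Nat.mul_le_mul_left _ hpΓ
  have happ : ∀ l, ∃ z ∈ Submodule.span ℂ (φ '' ((A (2 ^ l - 1) ∪ S : Finset ι) : Set ι)),
      ‖f₀ - z‖ ^ 2 ≤ 2 * e ^ 2 + 2 * β * τ l := fun l =>
    exists_partial_approximant hup T S (A (2 ^ l - 1)) (by omega) g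
  -- Before stage `l`, `K = B * (2 + 4 + ⋯ + 2 ^ l)` iterations are spent; the hypothesis on `K` is
  -- this geometric sum without subtraction.
  have hstep : ∀ l ≤ p, ∀ K, K + 2 * B = B * 2 ^ (l + 1) →
      ‖wompResidual φ f₀ j (k + (K + B * 2 ^ (l + 1)))‖ ^ 2 ≤
        2 * e ^ 2 + 2 * β * τ (l + 1) + ε * ‖wompResidual φ f₀ j (k + K)‖ ^ 2 := by
    intro l hl K hK
    obtain ⟨z, hz, hze⟩ := happ (l + 1)
    have hpos : (0 : ℝ) < 2 ^ (l + 1) := by positivity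
    have hone : (1 : ℝ) ≤ 2 ^ (l + 1) := one_le_pow₀ (by norm_num)
    have hcardN : (A (2 ^ (l + 1) - 1)).card ≤ 2 ^ (l + 1) :=
      (hA (2 ^ (l + 1) - 1)).2.1.trans (Nat.sub_le _ _)
    have hcard : ((A (2 ^ (l + 1) - 1)).card : ℝ) ≤ 2 ^ (l + 1) := by exact_mod_cast hcardN
    have hcardT : (A (2 ^ (l + 1) - 1)).card ≤ T.card :=
      (Finset.card_le_card (hA (2 ^ (l + 1) - 1)).1).trans hΓT
    have hpw : 2 ^ (l + 1) ≤ 2 * 2 ^ p := by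
      rw [← pow_succ']; exact Nat.pow_le_pow_right (by norm_num) (by omega)
    have hBl : B * 2 ^ (l + 1) ≤ B * (2 * 2 ^ p) := Nat.mul_le_mul_left _ hpw
    have hθ1 : t ^ 2 * α / β ≤ 1 := by
      rw [div_le_one hβ]
      have : t ^ 2 ≤ 1 := pow_le_one₀ ht.le ht1
      nlinarith
    have h := norm_sq_wompResidual_add_le (k := k + K) (K := B * 2 ^ (l + 1)) (s := 2 ^ (l + 1))
      (ε := ε) ht hα hβ hpos hlow hφ hj (A (2 ^ (l + 1) - 1)) hcard (z := z) ?_ ?_ ?_ ?_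
    · rw [← add_assoc]; linarith
    · refine Submodule.span_mono (Set.image_mono ?_) hz
      exact_mod_cast Finset.union_subset_union_right
        (Finset.image_subset_image (Finset.range_mono (Nat.le_add_right k K)))
    · nlinarith
    · rw [div_le_one hpos]; linarith
    · refine le_trans (le_of_eq ?_) hB
      congr 2
      push_cast
      field_simp
  have hinv : ∀ l ≤ p, ∃ K, K + 2 * B = B * 2 ^ (l + 1) ∧
      ‖wompResidual φ f₀ j (k + K)‖ ^ 2 ≤ 4 * e ^ 2 + 4 * β * τ l := by
    intro l
    induction l with
    | zero =>
      intro _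
      refine ⟨0, by ring, ?_⟩
      obtain ⟨z, hz, hze⟩ := happ 0
      have hA0 : A (2 ^ 0 - 1) = ∅ := by
        have := (hA (2 ^ 0 - 1)).2.1
        simpa using this
      rw [hA0, Finset.empty_union] at hz
      have := pow_le_pow_left₀ (norm_nonneg _) (norm_wompResidual_le φ f₀ j hz) 2
      rw [add_zero]
      nlinarith [sq_nonneg e, mul_nonneg hβ.le (hτ0 0)]
    | succ l ih =>
      intro hl
      obtain ⟨K, hK, hr⟩ := ih (by omega)
      refine ⟨K + B * 2 ^ (l + 1), by rw [pow_succ 2 (l + 1)]; linarith, ?_⟩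
      have h1 := hstep l (by omega) K hK
      have h2 := (hpmin l (by omega)).1
      have h3 : ε * ‖wompResidual φ f₀ j (k + K)‖ ^ 2 ≤ ε * (4 * e ^ 2 + 4 * β * τ l) := by
        gcongr
      have h4 : ε * (4 * β * τ l) ≤ ε * (4 * β * (M * τ (l + 1))) := by gcongr
      have h5 : ε * (4 * β * (M * τ (l + 1))) = 2 * β * τ (l + 1) := by
        linear_combination (4 * β * τ (l + 1)) * hεM
      nlinarith [sq_nonneg e]
  obtain ⟨K, hK, hr⟩ := hinv p le_rfl
  have hfin := hstep p le_rfl K hK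
  set k' := k + (K + B * 2 ^ (p + 1)) with hk'
  have hk'le : k' ≤ k + 4 * B * 2 ^ p := by rw [hk', pow_succ] at *; linarith
  -- Each tail term costs at most `α * τ p / 8`: one by the sharp drop at `p`, the other by the
  -- contraction `ε = α / (32 * β)`.
  have hfin' : ‖wompResidual φ f₀ j k'‖ ^ 2 ≤ 4 * e ^ 2 + α * τ p / 4 := by
    have h3 : ε * ‖wompResidual φ f₀ j (k + K)‖ ^ 2 ≤ ε * (4 * e ^ 2 + 4 * β * τ p) := by
      gcongr
    have h4 : ε * (4 * β * τ p) = α * τ p / 8 := by rw [hεd]; field_simp; ring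
    have h5 : 2 * β * τ (p + 1) ≤ α * τ p / 8 := by
      have : α * (M * τ (p + 1)) ≤ α * τ p := by gcongr
      have h6 : α * (M * τ (p + 1)) = 16 * β * τ (p + 1) := by rw [← hMβ]; ring
      linarith
    nlinarith [sq_nonneg e]
  set S' := (Finset.range k').image j with hS'
  have hSS' : S ⊆ S' := Finset.image_subset_image (Finset.range_mono (Nat.le_add_right _ _))
  have hTS' : T \ S' = Γ \ (Γ ∩ S') := by
    ext i
    simp only [hΓd, Finset.mem_sdiff, Finset.mem_inter]
    have := @hSS' i
    tauto
  -- If few indices were captured, optimality of `A` bounds `τ p` by the unselected mass, hence `α *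
  -- τ p ≤ (e + R) ^ 2`. With `R ^ 2 ≤ 4 * e ^ 2 + (e + R) ^ 2 / 4` this excludes `R > 5 * e`.
  by_cases hcap : (Γ ∩ S').card ≤ 2 ^ p - 1
  · left
    have h1 := (hA (2 ^ p - 1)).2.2 (Γ ∩ S') Finset.inter_subset_left hcap
    rw [← hTS'] at h1
    have h2 := sum_sq_unselected_le (f₀ := f₀) (j := j) (k := k') hα hlow T (by omega) g
    rw [← hS', ← he] at h2
    have hle : ‖wompResidual φ f₀ j (k + 4 * B * Γ.card)‖ ≤ ‖wompResidual φ f₀ j k'‖ :=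
      norm_wompResidual_antitone φ f₀ j (by omega)
    refine hle.trans ?_
    set R := ‖wompResidual φ f₀ j k'‖
    have hR0 : 0 ≤ R := norm_nonneg _
    have h3 : α * τ p ≤ (e + R) ^ 2 := (mul_le_mul_of_nonneg_left h1 hα.le).trans h2
    by_contra hcon
    have hcon := not_le.1 hcon
    nlinarith
  · right
    refine ⟨k', ?_⟩
    have h1 : (T \ S').card + (Γ ∩ S').card = Γ.card := by
      rw [hTS']; exact Finset.card_sdiff_add_card_eq_card Finset.inter_subset_left
    have h2 : 0 < 2 ^ p := by positivity
    have h3 : (T \ S').card + 2 ^ p ≤ Γ.card := by omega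
    have h4 := Nat.mul_le_mul_left (4 * B) h3
    rw [Nat.mul_add] at h4
    rw [← hS']
    exact ⟨by omega, by omega⟩

/-- The residual of the Weak Orthogonal Matching Pursuit after proportionally many iterations is
comparable with the error of sparse approximation. -/
theorem norm_wompResidual_le_sparse_error {φ : ι → H} {f₀ : H} {j : ℕ → ι} {u B : ℕ}
    {t α β : ℝ}
    (ht : 0 < t) (ht1 : t ≤ 1) (hα : 0 < α) (hαβ : α ≤ β)
    (hlow : ∀ J : Finset ι, J.card ≤ u → ∀ a : ι → ℂ,
      α * ∑ i ∈ J, ‖a i‖ ^ 2 ≤ ‖∑ i ∈ J, a i • φ i‖ ^ 2)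
    (hup : ∀ J : Finset ι, J.card ≤ u → ∀ a : ι → ℂ,
      ‖∑ i ∈ J, a i • φ i‖ ^ 2 ≤ β * ∑ i ∈ J, ‖a i‖ ^ 2)
    (hφ : ∀ i, ‖φ i‖ ^ 2 ≤ β)
    (hj : IsWOMPSelection φ t f₀ j)
    (hB : Real.exp (-(t ^ 2 * α / β * B)) ≤ α / (32 * β))
    (T : Finset ι) (hu : (1 + 4 * B) * T.card ≤ u) (g : ι → ℂ) :
    ‖wompResidual φ f₀ j (4 * B * T.card)‖ ≤ 5 * ‖f₀ - ∑ i ∈ T, g i • φ i‖ := by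
  -- The starting iteration `k` is left free: each capture lowers `n` without raising the deadline
  -- `k + 4 * B * n`.
  have key : ∀ n k, (T \ (Finset.range k).image j).card = n → T.card + (k + 4 * B * n) ≤ u →
      ‖wompResidual φ f₀ j (k + 4 * B * n)‖ ≤ 5 * ‖f₀ - ∑ i ∈ T, g i • φ i‖ := by
    intro n
    induction n using Nat.strong_induction_on with
    | _ n ih =>
      intro k hk hn
      rcases Nat.eq_zero_or_pos n with rfl | hpos
      · have hsub : T ⊆ (Finset.range k).image j :=
          Finset.sdiff_eq_empty_iff_subset.1 (Finset.card_eq_zero.1 hk)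
        have hmem : ∑ i ∈ T, g i • φ i ∈
            Submodule.span ℂ (φ '' (((Finset.range k).image j : Finset ι) : Set ι)) :=
          Submodule.sum_mem _ fun i hi => Submodule.smul_mem _ _
            (Submodule.subset_span ⟨i, by exact_mod_cast hsub hi, rfl⟩)
        have := norm_wompResidual_le φ f₀ j hmem
        rw [mul_zero, add_zero]
        linarith [norm_nonneg (f₀ - ∑ i ∈ T, g i • φ i)]
      · subst hk
        rcases wompResidual_le_or_card_unselected_lt ht ht1 hα hαβ hlow hup hφ hj hB T g hpos hn
          with h | ⟨k', h1, h2⟩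
        · exact h
        · exact (norm_wompResidual_antitone φ f₀ j h1).trans (ih _ h2 k' rfl (by omega))
  have := key T.card 0 (by simp) (by rw [zero_add]; linarith)
  rwa [zero_add] at this

end GreedyHilbert

/-! ### Sparse sets and best approximation errors. -/

section SparseSet

variable {E : Type*} [AddCommGroup E] [Module ℂ E] {N : ℕ}

theorem mem_sparseSet_of_card_le {φ : Fin N → E} {v : ℕ} (hv : v ≤ N) {J : Finset (Fin N)}
    (hJ : J.card ≤ v) {x : E} (hx : x ∈ Submodule.span ℂ (φ '' (J : Set (Fin N)))) :
    x ∈ sparseSet φ v := by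
  obtain ⟨J', hJJ', hJ'⟩ := Finset.exists_superset_card_eq hJ (by simpa using hv)
  refine ⟨J', hJ', Submodule.span_mono (Set.image_mono ?_) hx⟩
  exact_mod_cast hJJ'

theorem sparseSet_nonempty {φ : Fin N → E} {v : ℕ} (hv : v ≤ N) : (sparseSet φ v).Nonempty :=
  ⟨0, mem_sparseSet_of_card_le hv (J := ∅) (by simp) (zero_mem _)⟩

/-- The condition `v ≤ N` makes the sparse set nonempty, so the infimum is not a default value. No
minimizer is needed. -/
theorem le_mul_bestTermApprox {nrm : E → ℝ} {φ : Fin N → E} {v : ℕ} (hv : v ≤ N) {f : E}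
    {C x : ℝ} (hC : 0 ≤ C) (h : ∀ g ∈ sparseSet φ v, x ≤ C * nrm (f - g)) :
    x ≤ C * bestTermApprox nrm φ v f := by
  have : Nonempty (sparseSet φ v) := (sparseSet_nonempty hv).to_subtype
  rw [bestTermApprox, Real.mul_iInf_of_nonneg hC]
  exact le_ciInf fun g => h g g.2

end SparseSet

/-! ### Norms for the empirical and mixed measures. -/

section Norms

variable {Ω : Type*} [MeasurableSpace Ω]

theorem l2Norm_nonneg (ν : Measure Ω) (f : Ω → ℂ) : 0 ≤ l2Norm ν f := ENNReal.toReal_nonneg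

theorem l2Norm_add_le {ν : Measure Ω} {f g : Ω → ℂ} (hf : MemLp f 2 ν) (hg : MemLp g 2 ν) :
    l2Norm ν (f + g) ≤ l2Norm ν f + l2Norm ν g := by
  rw [l2Norm, l2Norm, l2Norm, ← ENNReal.toReal_add hf.2.ne hg.2.ne]
  exact ENNReal.toReal_mono (ENNReal.add_ne_top.2 ⟨hf.2.ne, hg.2.ne⟩)
    (eLpNorm_add_le hf.1 hg.1 (by norm_num))

theorem l2Norm_le_supNorm {ν : Measure Ω} [IsProbabilityMeasure ν] {f : Ω → ℂ}
    (hb : BddAbove (Set.range fun x => ‖f x‖)) : l2Norm ν f ≤ supNorm f := by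
  have h0 : 0 ≤ supNorm f := Real.iSup_nonneg fun x => norm_nonneg _
  refine ENNReal.toReal_le_of_le_ofReal h0 ?_
  refine (eLpNorm_le_of_ae_bound (C := supNorm f) (.of_forall fun x => le_ciSup hb x)).trans ?_
  simp

theorem isProbabilityMeasure_empiricalMeasure {m : ℕ} (hm : 1 ≤ m) (ξ : Fin m → Ω) :
    IsProbabilityMeasure (empiricalMeasure ξ) := by
  constructor
  simp only [empiricalMeasure, Measure.smul_apply, Measure.coe_finsetSum, Finset.sum_apply,
    measure_univ, Finset.sum_const, Finset.card_univ, Fintype.card_fin, nsmul_eq_mul, mul_one,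
    smul_eq_mul]
  exact ENNReal.inv_mul_cancel (by simpa using Nat.one_le_iff_ne_zero.1 hm) (by simp)

/-- The `L_2` norm is at most twice the `L_2` norm for a measure of at least half the mass. -/
theorem l2Norm_le_two_mul_l2Norm {ν ρ : Measure Ω} {f : Ω → ℂ} (hf : MemLp f 2 ρ)
    (h : (2 : ℝ≥0∞)⁻¹ • ν ≤ ρ) : l2Norm ν f ≤ 2 * l2Norm ρ f := by
  have h1 : ν ≤ (2 : ℝ≥0∞) • ρ := by
    calc ν = (2 : ℝ≥0∞) • ((2 : ℝ≥0∞)⁻¹ • ν) := by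
          rw [smul_smul, ENNReal.mul_inv_cancel (by norm_num) (by norm_num), one_smul]
      _ ≤ _ := by gcongr
  have h2 : eLpNorm f 2 ν ≤ 2 * eLpNorm f 2 ρ := by
    refine (eLpNorm_mono_measure f h1).trans ?_
    rw [eLpNorm_smul_measure_of_ne_zero (by norm_num), smul_eq_mul]
    gcongr
    calc (2 : ℝ≥0∞) ^ (1 / (2 : ℝ≥0∞)).toReal ≤ (2 : ℝ≥0∞) ^ (1 : ℝ) :=
          ENNReal.rpow_le_rpow_of_exponent_le (by norm_num) (by norm_num)
      _ = 2 := ENNReal.rpow_one _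
  have h3 := ENNReal.toReal_mono (ENNReal.mul_ne_top (by norm_num) hf.2.ne) h2
  rwa [ENNReal.toReal_mul] at h3

variable [MeasurableSingletonClass Ω] {m : ℕ}

theorem norm_sampleL2 (ξ : Fin m → Ω) (f : Ω → ℂ) :
    ‖sampleL2 ξ f‖ = l2Norm (empiricalMeasure ξ) f := Lp.norm_toLp _ _

theorem norm_sampleL2_sq (ξ : Fin m → Ω) (f : Ω → ℂ) :
    ‖sampleL2 ξ f‖ ^ 2 = 1 / (m : ℝ) * ∑ i, ‖f (ξ i)‖ ^ 2 := by
  have h := (memLp_empiricalMeasure ξ f).eLpNorm_eq_integral_rpow_norm (by norm_num) (by norm_num)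
  rw [norm_sampleL2, l2Norm, h, ENNReal.toReal_ofReal (by positivity)]
  simp only [ENNReal.toReal_ofNat]
  rw [← Real.rpow_natCast, ← Real.rpow_mul (by positivity)]
  norm_num
  rw [empiricalMeasure, integral_smul_measure, integral_finsetSum_measure]
  · simp
  · intro i _
    exact integrable_dirac (by simp)

theorem sampleL2_add (ξ : Fin m → Ω) (f g : Ω → ℂ) :
    sampleL2 ξ (f + g) = sampleL2 ξ f + sampleL2 ξ g := rfl

theorem sampleL2_sub (ξ : Fin m → Ω) (f g : Ω → ℂ) :
    sampleL2 ξ (f - g) = sampleL2 ξ f - sampleL2 ξ g := rfl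

theorem sampleL2_sum_smul {ι : Type*} (ξ : Fin m → Ω) (φ : ι → Ω → ℂ) (J : Finset ι)
    (a : ι → ℂ) :
    sampleL2 ξ (∑ i ∈ J, a i • φ i) = ∑ i ∈ J, a i • sampleL2 ξ (φ i) := by
  classical
  induction J using Finset.induction_on with
  | empty => rfl
  | insert i J hi ih =>
    rw [Finset.sum_insert hi, Finset.sum_insert hi, ← ih, sampleL2_add]
    rfl

end Norms

/-! ### Transfer between the sample and the whole domain. -/

section Discretization

variable {Ω : Type*} [MeasurableSpace Ω] {μ : Measure Ω} {N : ℕ} {φ : Fin N → Ω → ℂ}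
  {R₁ R₂ : ℝ} {u m : ℕ} {ξ : Fin m → Ω}

theorem RieszBounds.sum_finset (h : RieszBounds μ φ R₁ R₂) (J : Finset (Fin N)) (a : Fin N → ℂ) :
    R₁ * Real.sqrt (∑ i ∈ J, ‖a i‖ ^ 2) ≤ l2Norm μ (∑ i ∈ J, a i • φ i) ∧
      l2Norm μ (∑ i ∈ J, a i • φ i) ≤ R₂ * Real.sqrt (∑ i ∈ J, ‖a i‖ ^ 2) := by
  have h1 := h fun i => if i ∈ J then a i else 0
  have e1 : ∑ i, ‖if i ∈ J then a i else 0‖ ^ 2 = ∑ i ∈ J, ‖a i‖ ^ 2 := by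
    have : ∀ i, ‖if i ∈ J then a i else 0‖ ^ 2 = if i ∈ J then ‖a i‖ ^ 2 else 0 := by
      intro i
      split_ifs <;> simp
    simp_rw [this]
    rw [Finset.sum_ite_mem, Finset.univ_inter]
  have e2 : ∑ i, (if i ∈ J then a i else 0) • φ i = ∑ i ∈ J, a i • φ i := by
    simp_rw [ite_smul, zero_smul]
    rw [Finset.sum_ite_mem, Finset.univ_inter]
  rwa [e1, e2] at h1

variable [MeasurableSingletonClass Ω]

theorem sampleL2_riesz_bounds (hR₁ : 0 < R₁) (hφ : RieszBounds μ φ R₁ R₂)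
    (hξ : UniversalDiscretization μ φ u ξ) (huN : u ≤ N) (J : Finset (Fin N)) (hJ : J.card ≤ u)
    (a : Fin N → ℂ) :
    R₁ ^ 2 / 2 * ∑ i ∈ J, ‖a i‖ ^ 2 ≤ ‖∑ i ∈ J, a i • sampleL2 ξ (φ i)‖ ^ 2 ∧
      ‖∑ i ∈ J, a i • sampleL2 ξ (φ i)‖ ^ 2 ≤ 3 * R₂ ^ 2 / 2 * ∑ i ∈ J, ‖a i‖ ^ 2 := by
  have hmem : ∑ i ∈ J, a i • φ i ∈ sparseSet φ u :=
    mem_sparseSet_of_card_le huN hJ (Submodule.sum_mem _ fun i hi =>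
      Submodule.smul_mem _ _ (Submodule.subset_span ⟨i, hi, rfl⟩))
  have h1 := hξ _ hmem
  rw [← norm_sampleL2_sq, sampleL2_sum_smul] at h1
  have h2 := hφ.sum_finset J a
  have h0 : 0 ≤ ∑ i ∈ J, ‖a i‖ ^ 2 := Finset.sum_nonneg fun i _ => sq_nonneg _
  have h3 := pow_le_pow_left₀ (by positivity) h2.1 2
  have h4 := pow_le_pow_left₀ (l2Norm_nonneg _ _) h2.2 2
  rw [mul_pow, Real.sq_sqrt h0] at h3 h4
  constructor <;> linarith [h1.1, h1.2]

theorem l2Norm_le_two_mul_norm_sampleL2 (hξ : UniversalDiscretization μ φ u ξ) {f : Ω → ℂ}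
    (hf : f ∈ sparseSet φ u) : l2Norm μ f ≤ 2 * ‖sampleL2 ξ f‖ := by
  have h1 := (hξ f hf).1
  rw [← norm_sampleL2_sq] at h1
  refine abs_le_of_sq_le_sq' ?_ (by positivity) |>.2
  nlinarith [sq_nonneg ‖sampleL2 ξ f‖]

/-- The lower isometry bound kills every coefficient, so `f` vanishes at every point and not merely
almost everywhere. This gives uniqueness of the residual on `Ω`. -/
theorem eq_zero_of_sampleL2_eq_zero (hR₁ : 0 < R₁) (hφ : RieszBounds μ φ R₁ R₂)
    (hξ : UniversalDiscretization μ φ u ξ) (huN : u ≤ N) {J : Finset (Fin N)} (hJ : J.card ≤ u)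
    {f : Ω → ℂ} (hf : f ∈ Submodule.span ℂ (φ '' (J : Set (Fin N))))
    (h0 : sampleL2 ξ f = 0) : f = 0 := by
  obtain ⟨a, rfl⟩ := exists_sum_smul_eq_of_mem_span_image hf
  have h1 := (sampleL2_riesz_bounds hR₁ hφ hξ huN J hJ a).1
  rw [← sampleL2_sum_smul, h0, norm_zero, zero_pow two_ne_zero] at h1
  have h2 : ∑ i ∈ J, ‖a i‖ ^ 2 ≤ 0 := by
    by_contra hcon
    have := mul_pos (show 0 < R₁ ^ 2 / 2 by positivity) (not_le.1 hcon)
    linarith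
  have h3 := (Finset.sum_eq_zero_iff_of_nonneg fun i _ => sq_nonneg ‖a i‖).1
    (le_antisymm h2 (Finset.sum_nonneg fun i _ => sq_nonneg _))
  refine Finset.sum_eq_zero fun i hi => ?_
  have : a i = 0 := by simpa using h3 i hi
  rw [this, zero_smul]

theorem existsUnique_isResidualOn (hR₁ : 0 < R₁) (hφ : RieszBounds μ φ R₁ R₂)
    (hξ : UniversalDiscretization μ φ u ξ) (huN : u ≤ N) (f₀ : Ω → ℂ) (j : ℕ → Fin N) {k : ℕ}
    (hk : k ≤ u) : ∃! F : Ω → ℂ, IsResidualOn φ ξ f₀ j k F := by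
  set J := (Finset.range k).image j with hJ
  have hJu : J.card ≤ u := Finset.card_image_le.trans (by simpa using hk)
  obtain ⟨a, ha⟩ := exists_sum_smul_eq_of_mem_span_image
    (sub_wompResidual_mem (fun i => sampleL2 ξ (φ i)) (sampleL2 ξ f₀) j k)
  refine ⟨f₀ - ∑ i ∈ J, a i • φ i, ⟨?_, ?_⟩, ?_⟩
  · rw [sub_sub_cancel, range_selected_eq_image, ← hJ]
    exact Submodule.sum_mem _ fun i hi => Submodule.smul_mem _ _
      (Submodule.subset_span ⟨i, hi, rfl⟩)
  · rw [sampleL2_sub, sampleL2_sum_smul, hJ, ha, sub_sub_cancel]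
  · rintro F ⟨h1, h2⟩
    rw [range_selected_eq_image, ← hJ] at h1
    have hs : ∑ i ∈ J, a i • φ i ∈ Submodule.span ℂ (φ '' (J : Set (Fin N))) :=
      Submodule.sum_mem _ fun i hi => Submodule.smul_mem _ _
        (Submodule.subset_span ⟨i, hi, rfl⟩)
    have := eq_zero_of_sampleL2_eq_zero hR₁ hφ hξ huN hJu (sub_mem h1 hs) (by
      rw [sampleL2_sub, sampleL2_sub, sampleL2_sum_smul, hJ, ha, h2, sub_self])
    rw [eq_sub_iff_add_eq, add_comm, ← eq_sub_iff_add_eq]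
    exact (sub_eq_zero.1 this).symm

/-- The residual on the whole domain is controlled by the errors of sparse approximation on the
domain and on the sample points. -/
theorem l2Norm_residual_le (hξ : UniversalDiscretization μ φ u ξ) (huN : u ≤ N)
    {f₀ : Ω → ℂ} {j : ℕ → Fin N} {k v : ℕ} (hk : v + k ≤ u)
    (hφL : ∀ i, MemLp (φ i) 2 μ) (hf₀ : MemLp f₀ 2 μ) {g : Ω → ℂ} (hg : g ∈ sparseSet φ v)
    {F : Ω → ℂ} (hF : IsResidualOn φ ξ f₀ j k F) :
    l2Norm μ F ≤ l2Norm μ (f₀ - g) + 2 * (‖sampleL2 ξ (f₀ - g)‖ + ‖sampleL2 ξ F‖) := by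
  obtain ⟨T, hT, hgT⟩ := hg
  have h1 := hF.1
  rw [range_selected_eq_image] at h1
  set S := (Finset.range k).image j with hS
  have hcard : (T ∪ S).card ≤ u := by
    refine (Finset.card_union_le _ _).trans ?_
    have := Finset.card_image_le (s := Finset.range k) (f := j)
    rw [Finset.card_range, ← hS] at this
    omega
  have hmem : g - (f₀ - F) ∈ Submodule.span ℂ (φ '' ((T ∪ S : Finset (Fin N)) : Set (Fin N))) := by
    refine sub_mem (Submodule.span_mono (Set.image_mono ?_) hgT)
      (Submodule.span_mono (Set.image_mono ?_) h1)
    · exact_mod_cast Finset.subset_union_left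
    · exact_mod_cast Finset.subset_union_right
  have hspan : ∀ {J : Finset (Fin N)} {f : Ω → ℂ},
      f ∈ Submodule.span ℂ (φ '' (J : Set (Fin N))) → MemLp f 2 μ := by
    intro J f hf
    obtain ⟨a, rfl⟩ := exists_sum_smul_eq_of_mem_span_image hf
    exact memLp_finsetSum' _ fun i _ => (hφL i).const_smul (a i)
  -- Discretization applies to `g - (f₀ - F)`, which has at most `v + k ≤ u` terms, though not to
  -- `F` itself.
  have h2 := l2Norm_le_two_mul_norm_sampleL2 hξ (mem_sparseSet_of_card_le huN hcard hmem)
  have h3 := l2Norm_add_le (hf₀.sub (hspan hgT)) (hspan hmem)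
  rw [show f₀ - g + (g - (f₀ - F)) = F by abel] at h3
  have h4 : ‖sampleL2 ξ (g - (f₀ - F))‖ ≤ ‖sampleL2 ξ (f₀ - g)‖ + ‖sampleL2 ξ F‖ := by
    rw [show g - (f₀ - F) = F - (f₀ - g) by abel, sampleL2_sub, add_comm]
    exact norm_sub_le _ _
  linarith

end Discretization

/-! ### The main theorem. -/

theorem corollary6p4 :
    ∃ C : ℝ, 1 < C ∧
      ∀ t R₁ R₂ : ℝ, 0 < t → t ≤ 1 → 0 < R₁ → R₁ ≤ R₂ →
        ∃ c : ℕ, 1 ≤ c ∧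
          ∀ (Ω : Type*) [TopologicalSpace Ω] [LocallyCompactSpace Ω] [T2Space Ω]
            [MeasurableSpace Ω] [BorelSpace Ω] (μ : Measure Ω) [IsProbabilityMeasure μ]
            (N : ℕ) (φ : Fin N → Ω → ℂ),
            (∀ i, Measurable (φ i)) → (∀ i x, ‖φ i x‖ ≤ 1) → RieszBounds μ φ R₁ R₂ →
            ∀ (u m : ℕ) (ξ : Fin m → Ω),
              1 ≤ u → u ≤ N → 1 ≤ m → UniversalDiscretization μ φ u ξ →
              ∀ (v : ℕ) (f₀ : Ω → ℂ),
                (1 + c) * v ≤ u → Measurable f₀ → (∃ M : ℝ, ∀ x, ‖f₀ x‖ ≤ M) →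
                ∀ j : ℕ → Fin N,
                  IsWOMPSelection (fun i => sampleL2 ξ (φ i)) t (sampleL2 ξ f₀) j →
                  ‖wompResidual (fun i => sampleL2 ξ (φ i)) (sampleL2 ξ f₀) j (c * v)‖ ≤
                      C * bestTermApprox norm (fun i => sampleL2 ξ (φ i)) v (sampleL2 ξ f₀) ∧
                    (∃! F : Ω → ℂ, IsResidualOn φ ξ f₀ j (c * v) F) ∧
                    ∀ F : Ω → ℂ, IsResidualOn φ ξ f₀ j (c * v) F →
                      l2Norm μ F ≤ C * bestTermApprox supNorm φ v f₀ ∧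
                      l2Norm μ F ≤
                        C * bestTermApprox (l2Norm (mixedMeasure μ ξ)) φ v f₀ := by
  -- The mixed norm dictates `26 = 2 * (1 + 12)`; the uniform norm needs only `1 + 12`, and the
  -- sample only `5`.
  refine ⟨26, by norm_num, fun t R₁ R₂ ht ht1 hR₁ hR => ?_⟩
  set α : ℝ := R₁ ^ 2 / 2 with hαd
  set β : ℝ := 3 * R₂ ^ 2 / 2 with hβd
  have hα : 0 < α := by positivity
  have hαβ : α ≤ β := by
    have := pow_le_pow_left₀ hR₁.le hR 2
    rw [hαd, hβd]; nlinarith [sq_nonneg R₂]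
  have hβ : 0 < β := hα.trans_le hαβ
  obtain ⟨B, hB1, hB⟩ : ∃ B : ℕ, 1 ≤ B ∧
      Real.exp (-(t ^ 2 * α / β * B)) ≤ α / (32 * β) := by
    have hpos : 0 < t ^ 2 * α / β := by positivity
    have h1 : Filter.Tendsto (fun B : ℕ => Real.exp (-(t ^ 2 * α / β * B))) Filter.atTop
        (nhds 0) :=
      Real.tendsto_exp_neg_atTop_nhds_zero.comp
        (tendsto_natCast_atTop_atTop.const_mul_atTop hpos)
    have h2 : 0 < α / (32 * β) := by positivity
    obtain ⟨B, h3, h4⟩ := ((Filter.eventually_ge_atTop 1).and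
      (h1.eventually (ge_mem_nhds h2))).exists
    exact ⟨B, h3, h4⟩
  refine ⟨4 * B, by omega, ?_⟩
  intro Ω _ _ _ _ _ μ _ N φ hφm hφ1 hφR u m ξ hu1 huN hm hξ v f₀ hv hf₀m hf₀b j hj
  have hvu : v ≤ u := le_trans (by nlinarith) hv
  have hku : v + 4 * B * v ≤ u := by linarith
  have hbounds := sampleL2_riesz_bounds hR₁ hφR hξ huN
  have hnorm : ∀ i, ‖sampleL2 ξ (φ i)‖ ^ 2 ≤ β := by
    intro i
    have := (hbounds {i} (by simpa using hu1) fun _ => 1).2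
    simpa using this
  have hmain : ∀ g ∈ sparseSet (fun i => sampleL2 ξ (φ i)) v,
      ‖wompResidual (fun i => sampleL2 ξ (φ i)) (sampleL2 ξ f₀) j (4 * B * v)‖ ≤
        5 * ‖sampleL2 ξ f₀ - g‖ := by
    rintro g ⟨T, rfl, hg⟩
    obtain ⟨a, rfl⟩ := exists_sum_smul_eq_of_mem_span_image hg
    exact norm_wompResidual_le_sparse_error ht ht1 hα hαβ (fun J hJ a => (hbounds J hJ a).1)
      (fun J hJ a => (hbounds J hJ a).2) hnorm hj hB T hv a
  have := isProbabilityMeasure_empiricalMeasure hm ξ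
  obtain ⟨M, hM⟩ := hf₀b
  refine ⟨le_mul_bestTermApprox (hvu.trans huN) (by norm_num) fun g hg =>
      (hmain g hg).trans (by linarith [norm_nonneg (sampleL2 ξ f₀ - g)]),
    existsUnique_isResidualOn hR₁ hφR hξ huN f₀ j (by omega), fun F hF => ?_⟩
  have hφL : ∀ i, MemLp (φ i) 2 μ := fun i =>
    MemLp.of_bound (hφm i).aestronglyMeasurable 1 (.of_forall (hφ1 i))
  have hf₀L : MemLp f₀ 2 μ := MemLp.of_bound hf₀m.aestronglyMeasurable M (.of_forall hM)
  -- Here `12 = 2 * (1 + 5)`: the factor 2 is from discretization, the 5 from the Hilbert space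
  -- bound. Measurability and boundedness of `f₀ - g` keep its norms finite.
  have hgen : ∀ g ∈ sparseSet φ v,
      l2Norm μ F ≤ l2Norm μ (f₀ - g) + 12 * l2Norm (empiricalMeasure ξ) (f₀ - g) ∧
        Measurable (f₀ - g) ∧ ∃ M', ∀ x, ‖(f₀ - g) x‖ ≤ M' := by
    intro g hg
    have h1 := l2Norm_residual_le hξ huN hku hφL hf₀L hg hF
    obtain ⟨T, hT, hgT⟩ := hg
    obtain ⟨a, rfl⟩ := exists_sum_smul_eq_of_mem_span_image hgT
    refine ⟨?_, ?_, ?_⟩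
    · have h2 := hmain (∑ i ∈ T, a i • sampleL2 ξ (φ i)) ⟨T, hT,
        Submodule.sum_mem _ fun i hi => Submodule.smul_mem _ _
          (Submodule.subset_span ⟨i, hi, rfl⟩)⟩
      rw [← hF.2, ← sampleL2_sum_smul, ← sampleL2_sub] at h2
      rw [← norm_sampleL2]
      linarith
    · have := Finset.measurable_sum T fun i _ => (hφm i).const_smul (a i)
      simp_rw [← Finset.sum_apply] at this
      exact hf₀m.sub this
    · refine ⟨M + ∑ i ∈ T, ‖a i‖, fun x => ?_⟩
      rw [Pi.sub_apply, Finset.sum_apply]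
      refine (norm_sub_le _ _).trans (add_le_add (hM x) ((norm_sum_le _ _).trans ?_))
      refine Finset.sum_le_sum fun i _ => ?_
      rw [Pi.smul_apply, norm_smul]
      exact mul_le_of_le_one_right (norm_nonneg _) (hφ1 i x)
  refine ⟨le_mul_bestTermApprox (hvu.trans huN) (by norm_num) fun g hg => ?_,
    le_mul_bestTermApprox (hvu.trans huN) (by norm_num) fun g hg => ?_⟩
  · obtain ⟨h1, -, M', h3⟩ := hgen g hg
    have hb : BddAbove (Set.range fun x => ‖(f₀ - g) x‖) :=
      ⟨M', by rintro _ ⟨x, rfl⟩; exact h3 x⟩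
    have h4 := l2Norm_le_supNorm (ν := μ) hb
    have h5 := l2Norm_le_supNorm (ν := empiricalMeasure ξ) hb
    linarith [l2Norm_nonneg μ (f₀ - g)]
  · obtain ⟨h1, h2, M', h3⟩ := hgen g hg
    have hL : MemLp (f₀ - g) 2 (mixedMeasure μ ξ) := by
      refine MemLp.smul_measure ?_ (by norm_num)
      exact MemLp.of_bound h2.aestronglyMeasurable M' (.of_forall h3)
    have h4 : l2Norm μ (f₀ - g) ≤ 2 * l2Norm (mixedMeasure μ ξ) (f₀ - g) := by
      refine l2Norm_le_two_mul_l2Norm hL ?_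
      rw [mixedMeasure, smul_add]
      exact Measure.le_add_right le_rfl
    have h5 : l2Norm (empiricalMeasure ξ) (f₀ - g) ≤
        2 * l2Norm (mixedMeasure μ ξ) (f₀ - g) := by
      refine l2Norm_le_two_mul_l2Norm hL ?_
      rw [mixedMeasure, smul_add]
      exact Measure.le_add_left le_rfl
    linarith
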